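/- Let $G$ be a finite connected weighted multigraph (loops and multiple edges allowed) with vertex set $V\neq\emptyset$, edge set $E$, a fixed orientation with tail $e^-$ and head $e^+$ of each edge $e$, and edge lengths $\ell(e)>0$. Let $\Gamma$ be the tropical curve (metric graph) that is the geometric realization of $G$, obtained from $V$ and the intervals $[0,\ell(e)]$ by gluing $0$ to $e^-$ and $\ell(e)$ to $e^+$. The image of $[0,\ell(e)]$ in $\Gamma$ is called the segment $e$. On $C_1(G,\mathbb R)=\mathbb R^{E}$ use the inner product $\langle\alpha,\beta\rangle=\sum_e\alpha(e)\beta(e)\ell(e)$ and the norm $\|\alpha\|_{\sup}=\max_e|\alpha(e)|$ (which is $0$ if $E=\emptyset$). Let $H_1(G,\mathbb R)$ be the space of real $1$-cycles, $H_1(\Gamma,\mathbb Z)$ the group of integral $1$-cycles, $g(\Gamma)=\operatorname{rk}H_1(\Gamma,\mathbb Z)$ the genus, and $\pi:C_1(G,\mathbb R)\to H_1(G,\mathbb R)$ the orthogonal projection. The Foster coefficient of an edge $e$ is $F(e)=\|\pi(e)\|_{\sup}$, and Zhang's measure on $\Gamma$ is $\mu_{Zh}=\sum_{e}F(e)\,\frac{dx|_e}{\ell(e)}$,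 where $dx|_e$ is Lebesgue measure on $e\cong[0,\ell(e)]$. Let $\Omega(\Gamma)$ be the space of harmonic $1$-forms $\omega=\sum_e\omega_e\,de$, that is, $\sum_{e^+=x}\omega_e=\sum_{e^-=x}\omega_e$ for all $x\in V$. Every $1$-chain $\alpha$ defines a functional $\int_\alpha\in\Omega(\Gamma)^*$ by $\int_\alpha\omega=\sum_e\alpha(e)\,\omega_e\,\ell(e)$; every element of $\Omega(\Gamma)^*$ is of this form, and $\|\int_\alpha\|_{\sup}=\|\pi(\alpha)\|_{\sup}$ is a well-defined norm on $\Omega(\Gamma)^*$. Endow the Jacobian $J(\Gamma)=\Omega(\Gamma)^*/H_1(\Gamma,\mathbb Z)$, where $\alpha\in H_1(\Gamma,\mathbb Z)$ is identified with $\int_\alpha$, with the quotient metric of this norm (the sup-norm or Foster/Zhang metric). For $p\in\Gamma$ let $\Phi_p:\Gamma\to J(\Gamma)$ be the Abel–Jacobi map: $\Phi_p(q)$ is the class of the functional $\omega\mapsto\int_P\omega$ for any path $P$ in $\Gamma$ from $p$ to $q$. The length of a subset of $J(\Gamma)$ is its one-dimensional Hausdorff measure for the Foster/Zhang metric. Theorem.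 Let $p\in\Gamma$ be any base point. 1. For every segment $e$, the image $\Phi_p(e)$ has length $F(e)$; the curve $[0,\ell(e)]\to J(\Gamma)$ given by $\Phi_p$ on $e$ also has length (total variation) $F(e)$; and $\mu_{Zh}(e)=F(e)$. 2. The image $\Phi_p(\Gamma)$ has total length $g(\Gamma)$; also, the lengths of the images $\Phi_p(e)$ of all the segments add up to $g(\Gamma)$. 3. For every segment $e$, the image $\Phi_p(e)$ has length at most $1$, with equality if and only if $e$ is a loop, that is, $e^-=e^+$. -/

import Mathlib

open MeasureTheory Set

/-- A weighted graph: a connected multigraph, loops and multiple edges allowed, with a fixed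
orientation and a positive length for every edge. -/
structure WeightedGraph (V E : Type*) where
  tail : E → V
  head : E → V
  len : E → ℝ
  len_pos : ∀ e, 0 < len e
  nonempty : Nonempty V
  connected : ∀ x y : V, Relation.ReflTransGen
    (fun v w => ∃ e, (tail e = v ∧ head e = w) ∨ (tail e = w ∧ head e = v)) x y

namespace WeightedGraph

variable {V E : Type*} (G : WeightedGraph V E)

/-! ### The tropical curve -/

theorem zero_mem_Icc (e : E) : (0 : ℝ) ∈ Icc (0 : ℝ) (G.len e) := left_mem_Icc.2 (G.len_pos e).le

theorem len_mem_Icc (e : E) : G.len e ∈ Icc (0 : ℝ) (G.len e) := right_mem_Icc.2 (G.len_pos e).le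

/-- The endpoint `0` of `[0, ℓ(e)]` is glued to the tail of `e`, the endpoint `ℓ(e)` to its
head. -/
inductive Glue : V ⊕ (Σ e, Icc (0 : ℝ) (G.len e)) → V ⊕ (Σ e, Icc (0 : ℝ) (G.len e)) → Prop
  | tail (e : E) : Glue (Sum.inr ⟨e, 0, G.zero_mem_Icc e⟩) (Sum.inl (G.tail e))
  | head (e : E) : Glue (Sum.inr ⟨e, G.len e, G.len_mem_Icc e⟩) (Sum.inl (G.head e))

/-- The tropical curve (metric graph) `Γ` that is the geometric realization of the weighted graph
`G`, with `G` as its preferred model: the vertices and the segments `[0, ℓ(e)]`, glued. -/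
def Curve : Type _ := Quot G.Glue

/-- The point of `Γ` given by a vertex. -/
def vertex (v : V) : G.Curve := Quot.mk _ (Sum.inl v)

/-- The point of the segment `e` at distance `t` from its tail. -/
def point (e : E) (t : Icc (0 : ℝ) (G.len e)) : G.Curve := Quot.mk _ (Sum.inr ⟨e, t⟩)

/-- The segment of `Γ` that is the realization of the edge `e`. -/
def segment (e : E) : Set G.Curve := range (G.point e)

/-- The topology of the gluing; the vertices are discrete before the gluing and therefore put no
condition on an open set. -/
instance : TopologicalSpace G.Curve := ⨆ e, TopologicalSpace.coinduced (G.point e) inferInstance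

instance : MeasurableSpace G.Curve := borel _

instance : BorelSpace G.Curve := ⟨rfl⟩

/-! ### Paths -/

/-- Paths from `x` to `y` in `Γ`: finitely many moves, each along an edge `e`, from the point at
distance `s` from the tail to the point at distance `t` (backwards if `t < s`). The paths in the
refinements of `G` that have `x` and `y` among their vertices are of this form, each of their edges
being a subsegment of an edge of `G`. -/
inductive Path (x : G.Curve) : G.Curve → Type _
  | nil : Path x x
  | cons (e : E) (s t : Icc (0 : ℝ) (G.len e)) (P : Path x (G.point e s)) : Path x (G.point e t)

theorem point_zero (e : E) : G.point e ⟨0, G.zero_mem_Icc e⟩ = G.vertex (G.tail e) :=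
  Quot.sound (Glue.tail e)

theorem point_len (e : E) : G.point e ⟨G.len e, G.len_mem_Icc e⟩ = G.vertex (G.head e) :=
  Quot.sound (Glue.head e)

theorem exists_path (x y : G.Curve) : Nonempty (G.Path x y) := by
  have step : ∀ (e : E) (s t : Icc (0 : ℝ) (G.len e)),
      Nonempty (G.Path x (G.point e s)) → Nonempty (G.Path x (G.point e t)) :=
    fun e s t ⟨P⟩ => ⟨.cons e s t P⟩
  have h0 : ∃ v, Nonempty (G.Path x (G.vertex v)) := by
    induction x using Quot.ind with
    | mk a =>
      rcases a with v | ⟨e, s⟩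
      · exact ⟨v, ⟨.nil⟩⟩
      · refine ⟨G.tail e, ?_⟩
        rw [← point_zero]
        exact step e s _ ⟨.nil⟩
  have h1 : ∀ w, Nonempty (G.Path x (G.vertex w)) := by
    obtain ⟨v, hv⟩ := h0
    intro w
    induction G.connected v w with
    | refl => exact hv
    | tail _ h ih =>
      obtain ⟨e, ⟨rfl, rfl⟩ | ⟨rfl, rfl⟩⟩ := h
      · rw [← point_zero] at ih
        rw [← point_len]
        exact step e _ _ ih
      · rw [← point_len] at ih
        rw [← point_zero]
        exact step e _ _ ih
  induction y using Quot.ind with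
  | mk a =>
    rcases a with w | ⟨e, t⟩
    · exact h1 w
    · exact step e _ t (G.point_zero e ▸ h1 (G.tail e))

/-! ### Chains, cycles and the orthogonal projection

Real `1`-chains `C₁(G, ℝ)` and `0`-chains `C₀(G, ℝ)` are written as functions `E → ℝ` and
`V → ℝ`. -/

/-- The supremum norm `max |α(e)|` of a `1`-chain (and `0` if there are no edges). -/
noncomputable def supNorm (α : E → ℝ) : ℝ := ⨆ e, |α e|

theorem supNorm_nonneg (α : E → ℝ) : 0 ≤ supNorm α :=
  Real.iSup_nonneg fun _ => abs_nonneg _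

open Classical in
/-- An edge regarded as a `1`-chain. -/
noncomputable def edgeChain (e : E) : E → ℝ := Pi.single e 1

variable [Fintype E]

/-- The inner product `⟨α, β⟩ = ∑ e, α(e) β(e) ℓ(e)` on `C₁(G, ℝ)`. -/
noncomputable def chainInner : LinearMap.BilinForm ℝ (E → ℝ) :=
  LinearMap.mk₂ ℝ (fun α β => ∑ e, α e * β e * G.len e)
    (fun α α' β => by simp [add_mul, Finset.sum_add_distrib])
    (fun c α β => by simp [Finset.mul_sum, mul_assoc])
    (fun α β β' => by simp [mul_add, add_mul, Finset.sum_add_distrib])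
    (fun c α β => by simp [Finset.mul_sum, mul_assoc, mul_left_comm])

theorem chainInner_apply (α β : E → ℝ) : G.chainInner α β = ∑ e, α e * β e * G.len e := rfl

theorem chainInner_comm (α β : E → ℝ) : G.chainInner α β = G.chainInner β α := by
  simp [chainInner_apply, mul_comm]

theorem chainInner_self {α : E → ℝ} (h : G.chainInner α α = 0) : α = 0 := by
  have h' := (Finset.sum_eq_zero_iff_of_nonneg fun e _ =>
    mul_nonneg (mul_self_nonneg (α e)) (G.len_pos e).le).1 h
  funext e
  have := h' e (Finset.mem_univ e)
  simpa [(G.len_pos e).ne'] using this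

open Classical in
/-- The operator `d* : C₁(G, ℝ) → C₀(G, ℝ)`. -/
noncomputable def boundary : (E → ℝ) →ₗ[ℝ] (V → ℝ) where
  toFun α x := ∑ e with G.head e = x, α e - ∑ e with G.tail e = x, α e
  map_add' α β := by
    funext x
    simp only [Finset.sum_add_distrib, Pi.add_apply]
    ring
  map_smul' r α := by
    funext x
    simp only [← Finset.mul_sum, Pi.smul_apply, smul_eq_mul, RingHom.id_apply]
    ring

/-- The real cycles `H₁(G, ℝ) = ker d*`. -/
noncomputable def cycles : Submodule ℝ (E → ℝ) := LinearMap.ker G.boundary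

/-- The integral cycles `H₁(G, ℤ) = H₁(G, ℝ) ∩ C₁(G, ℤ)`. -/
noncomputable def intCycles : AddSubgroup (E → ℝ) where
  carrier := {α | α ∈ G.cycles ∧ ∀ e, ∃ n : ℤ, α e = n}
  zero_mem' := ⟨G.cycles.zero_mem, fun _ => ⟨0, by simp⟩⟩
  add_mem' := by
    rintro α β ⟨hα, hα'⟩ ⟨hβ, hβ'⟩
    refine ⟨G.cycles.add_mem hα hβ, fun e => ?_⟩
    obtain ⟨m, hm⟩ := hα' e
    obtain ⟨n, hn⟩ := hβ' e
    exact ⟨m + n, by simp [hm, hn]⟩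
  neg_mem' := by
    rintro α ⟨hα, hα'⟩
    refine ⟨G.cycles.neg_mem hα, fun e => ?_⟩
    obtain ⟨m, hm⟩ := hα' e
    exact ⟨-m, by simp [hm]⟩

/-- The genus `g = rk H₁(G, ℤ)`. -/
noncomputable def genus : ℕ := Module.finrank ℤ G.intCycles

theorem isCompl_cycles : IsCompl G.cycles (G.chainInner.orthogonal G.cycles) := by
  refine (LinearMap.BilinForm.isCompl_orthogonal_iff_disjoint
    fun α β h => by rw [chainInner_comm, h]).2 (Submodule.disjoint_def.2 fun α hα hα' => ?_)
  exact G.chainInner_self (hα' α hα)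

/-- The orthogonal projection `π : C₁(G, ℝ) → H₁(G, ℝ) ⊆ C₁(G, ℝ)`. -/
noncomputable def proj : (E → ℝ) →ₗ[ℝ] (E → ℝ) :=
  G.cycles.projection (G.chainInner.orthogonal G.cycles) G.isCompl_cycles

theorem proj_mem (α : E → ℝ) : G.proj α ∈ G.cycles :=
  Submodule.projection_apply_mem _ _

theorem chainInner_sub_proj (α : E → ℝ) {γ : E → ℝ} (hγ : γ ∈ G.cycles) :
    G.chainInner γ (α - G.proj α) = 0 :=
  Submodule.sub_projection_mem G.isCompl_cycles α γ hγ

theorem proj_of_mem_cycles {α : E → ℝ} (hα : α ∈ G.cycles) : G.proj α = α :=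
  Submodule.projection_apply_left G.isCompl_cycles ⟨α, hα⟩

/-- The Foster coefficient `F(e) = ‖π(e)‖_sup`. -/
noncomputable def foster (e : E) : ℝ := supNorm (G.proj (edgeChain e))

/-! ### Harmonic `1`-forms and integration -/

open Classical in
/-- The space `Ω(G)` of harmonic `1`-forms `∑ ω(e) de`, written through their coefficients. -/
noncomputable def Harmonic : Submodule ℝ (E → ℝ) where
  carrier := {ω | ∀ x : V, ∑ e with G.head e = x, ω e = ∑ e with G.tail e = x, ω e}
  zero_mem' := fun x => by simp
  add_mem' := by
    intro a b ha hb x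
    simp only [Pi.add_apply, Finset.sum_add_distrib]
    rw [ha x, hb x]
  smul_mem' := by
    intro c a ha x
    simp only [Pi.smul_apply, smul_eq_mul, ← Finset.mul_sum]
    rw [ha x]

/-- The dual space `Ω(G)*` of the space of harmonic `1`-forms. -/
abbrev HarmonicDual : Type _ := Module.Dual ℝ G.Harmonic

/-- The functional `∫_α ∈ Ω(G)*` of integration along the `1`-chain `α`, determined by
`∫_e de = ℓ(e)` and `∫_e' de = 0` for `e ≠ e'`. -/
noncomputable def integral : (E → ℝ) →ₗ[ℝ] G.HarmonicDual where
  toFun α := G.chainInner α ∘ₗ G.Harmonic.subtype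
  map_add' α β := by rw [map_add, LinearMap.add_comp]
  map_smul' c α := by rw [map_smul, LinearMap.smul_comp, RingHom.id_apply]

theorem integral_apply (α : E → ℝ) (ω : G.Harmonic) :
    G.integral α ω = ∑ e, α e * (ω : E → ℝ) e * G.len e := rfl

theorem mem_harmonic_iff {α : E → ℝ} : α ∈ G.Harmonic ↔ α ∈ G.cycles := by
  refine ⟨fun h => LinearMap.mem_ker.2 (funext fun x => sub_eq_zero.2 (h x)), fun h x => ?_⟩
  exact sub_eq_zero.1 (congrFun (LinearMap.mem_ker.1 h) x)

theorem integral_surjective : Function.Surjective G.integral := by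
  classical
  intro s
  obtain ⟨s', hs'⟩ := LinearMap.exists_extend s
  refine ⟨fun e => s' (Pi.single e 1) / G.len e, LinearMap.ext fun ω => ?_⟩
  rw [← hs', integral_apply, LinearMap.comp_apply, Submodule.subtype_apply,
    LinearMap.pi_apply_eq_sum_univ s' (ω : E → ℝ)]
  refine Finset.sum_congr rfl fun e _ => ?_
  have h1 := (G.len_pos e).ne'
  have h2 : (fun j => if e = j then (1 : ℝ) else 0) = Pi.single e 1 := by
    funext j
    simp [Pi.single_apply, eq_comm]
  rw [h2, smul_eq_mul]
  field_simp

theorem integral_proj (α : E → ℝ) : G.integral (G.proj α) = G.integral α := by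
  refine (sub_eq_zero.1 ?_).symm
  rw [← map_sub]
  refine LinearMap.ext fun ω => ?_
  have h := G.chainInner_sub_proj α (G.mem_harmonic_iff.1 ω.2)
  rwa [chainInner_comm] at h

/-- `∫_α = ∫_β` implies `π(α) = π(β)`. -/
theorem proj_eq_of_integral_eq {α β : E → ℝ} (h : G.integral α = G.integral β) :
    G.proj α = G.proj β := by
  have hmem : G.proj α - G.proj β ∈ G.cycles := sub_mem (G.proj_mem α) (G.proj_mem β)
  refine sub_eq_zero.1 (G.chainInner_self ?_)
  have h0 : G.integral (G.proj α - G.proj β) = 0 := by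
    rw [map_sub, integral_proj, integral_proj, h, sub_self]
  exact LinearMap.congr_fun h0 ⟨_, G.mem_harmonic_iff.2 hmem⟩

/-! ### The Foster/Zhang norm -/

theorem abs_le_supNorm (α : E → ℝ) (e : E) : |α e| ≤ supNorm α :=
  le_ciSup (f := fun e => |α e|) (Set.finite_range _).bddAbove e

/-- The Foster/Zhang norm on `Ω(G)*`: `‖∫_α‖ = ‖π(α)‖_sup`. -/
noncomputable def fosterNorm (s : G.HarmonicDual) : ℝ :=
  supNorm (G.proj (G.integral_surjective s).choose)

theorem fosterNorm_integral (α : E → ℝ) :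
    G.fosterNorm (G.integral α) = supNorm (G.proj α) := by
  rw [fosterNorm, G.proj_eq_of_integral_eq (G.integral_surjective (G.integral α)).choose_spec]

theorem fosterNorm_smul (c : ℝ) (s : G.HarmonicDual) :
    G.fosterNorm (c • s) = |c| * G.fosterNorm s := by
  obtain ⟨α, rfl⟩ := G.integral_surjective s
  rw [← map_smul, fosterNorm_integral, fosterNorm_integral, map_smul, supNorm, supNorm,
    Real.mul_iSup_of_nonneg (abs_nonneg c)]
  exact iSup_congr fun e => abs_mul c (G.proj α e)

noncomputable instance : NormedAddCommGroup G.HarmonicDual :=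
  AddGroupNorm.toNormedAddCommGroup
    { toFun := G.fosterNorm
      map_zero' := by simpa using G.fosterNorm_smul 0 0
      add_le' := by
        intro s t
        obtain ⟨α, rfl⟩ := G.integral_surjective s
        obtain ⟨β, rfl⟩ := G.integral_surjective t
        rw [← map_add, fosterNorm_integral, fosterNorm_integral, fosterNorm_integral, map_add]
        refine Real.iSup_le (fun e => ?_) (add_nonneg (supNorm_nonneg _) (supNorm_nonneg _))
        exact (abs_add_le _ _).trans (add_le_add (abs_le_supNorm _ e) (abs_le_supNorm _ e))
      neg' := by
        intro s
        have h := G.fosterNorm_smul (-1) s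
        rwa [neg_one_smul ℝ s, abs_neg, abs_one, one_mul] at h
      eq_zero_of_map_eq_zero' := by
        intro s hs
        obtain ⟨α, rfl⟩ := G.integral_surjective s
        rw [fosterNorm_integral] at hs
        have h0 : G.proj α = 0 := funext fun e =>
          abs_eq_zero.1 (le_antisymm (hs ▸ abs_le_supNorm _ e) (abs_nonneg _))
        rw [← G.integral_proj α, h0, map_zero] }

theorem norm_integral (α : E → ℝ) : ‖G.integral α‖ = supNorm (G.proj α) :=
  G.fosterNorm_integral α

/-! ### The Jacobian -/

/-- The image of `H₁(G, ℤ)` in `Ω(G)*` under `α ↦ ∫_α`. -/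
noncomputable def periods : AddSubgroup G.HarmonicDual :=
  G.intCycles.map G.integral.toAddMonoidHom

instance isClosed_periods : IsClosed (G.periods : Set G.HarmonicDual) := by
  refine Metric.isClosed_of_pairwise_le_dist one_pos ?_
  intro s hs t ht hst
  obtain ⟨α, hα, h⟩ := AddSubgroup.mem_map.1 (sub_mem hs ht)
  replace h : G.integral α = s - t := h
  have hne : α ≠ 0 := by
    rintro rfl
    rw [map_zero] at h
    exact hst (sub_eq_zero.1 h.symm)
  obtain ⟨e, he⟩ := Function.ne_iff.1 hne
  rw [dist_eq_norm, ← h, norm_integral, proj_of_mem_cycles _ hα.1]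
  refine le_trans ?_ (abs_le_supNorm α e)
  obtain ⟨n, hn⟩ := hα.2 e
  rw [hn] at he ⊢
  exact_mod_cast Int.one_le_abs (by simpa using he)

/-- The Jacobian `J = Ω(G)* / H₁(G, ℤ)`. Its metric is the quotient of the Foster/Zhang metric
`‖s - t‖` on `Ω(G)*`. -/
abbrev Jacobian : Type _ := G.HarmonicDual ⧸ G.periods

noncomputable instance : MeasurableSpace G.Jacobian := borel _

instance : BorelSpace G.Jacobian := ⟨rfl⟩

/-- Zhang's measure `μ_Zh = ∑ e, F(e) dx|_e / ℓ(e)`, with `dx|_e` the Lebesgue measure on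
`e ≅ [0, ℓ(e)]`. -/
noncomputable def zhangMeasure : Measure G.Curve :=
  ∑ e, ENNReal.ofReal (G.foster e / G.len e) • Measure.map (G.point e) (Measure.comap Subtype.val volume)

/-! ### The Abel-Jacobi map -/

/-- The integral of harmonic `1`-forms along the edge `e` from `s` to `t`: `ω ↦ ω(e) (t - s)`. -/
noncomputable def moveIntegral (e : E) (s t : ℝ) : G.HarmonicDual :=
  (t - s) • (LinearMap.proj e ∘ₗ G.Harmonic.subtype)

variable {G} in
/-- The functional `∫_P ∈ Ω(G)*` of integration along the path `P`. -/
noncomputable def Path.integral {x y : G.Curve} : G.Path x y → G.HarmonicDual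
  | .nil => 0
  | .cons e s t P => P.integral + G.moveIntegral e s t

/-- The Abel-Jacobi map `Φ_p : Γ → J`: the class of `∫_P` for a path `P` from `p` to `q`. The class
does not depend on the path, see `abelJacobi_eq`. -/
noncomputable def abelJacobi (p q : G.Curve) : G.Jacobian :=
  QuotientAddGroup.mk (G.exists_path p q).some.integral

open Classical in
theorem boundary_edgeChain (e : E) :
    G.boundary (edgeChain e) = Pi.single (G.head e) 1 - Pi.single (G.tail e) 1 := by
  funext x
  simp [boundary, edgeChain, Pi.single_apply, Finset.sum_ite_eq, eq_comm]

open Classical in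
/-- There is an integral chain with boundary `w - v`. -/
theorem exists_chain (v w : V) : ∃ c : E → ℝ, (∀ e, ∃ n : ℤ, c e = n) ∧
    G.boundary c = Pi.single w 1 - Pi.single v 1 := by
  induction G.connected v w with
  | refl => exact ⟨0, fun _ => ⟨0, by simp⟩, by simp⟩
  | tail _ h ih =>
    obtain ⟨c, hc, hb⟩ := ih
    obtain ⟨e, ⟨rfl, rfl⟩ | ⟨rfl, rfl⟩⟩ := h
    · refine ⟨c + edgeChain e, fun e' => ?_, ?_⟩
      · obtain ⟨n, hn⟩ := hc e'
        exact ⟨n + if e' = e then 1 else 0, by simp [hn, edgeChain, Pi.single_apply]⟩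
      · rw [map_add, hb, boundary_edgeChain]
        abel
    · refine ⟨c - edgeChain e, fun e' => ?_, ?_⟩
      · obtain ⟨n, hn⟩ := hc e'
        exact ⟨n - if e' = e then 1 else 0, by simp [hn, edgeChain, Pi.single_apply]⟩
      · rw [map_sub, hb, boundary_edgeChain]
        abel

theorem integral_edgeChain (e : E) : G.integral (edgeChain e) = G.moveIntegral e 0 (G.len e) := by
  refine LinearMap.ext fun ω => ?_
  rw [integral_apply, Finset.sum_eq_single e]
  · simp [edgeChain, moveIntegral, mul_comm]
  · intro e' _ h
    simp [edgeChain, h]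
  · simp

theorem moveIntegral_add (e : E) (r s t : ℝ) :
    G.moveIntegral e r s + G.moveIntegral e s t = G.moveIntegral e r t := by
  simp only [moveIntegral]
  module

/-- The integrals along two paths with the same endpoints differ by an integral cycle: along a path
the class of the integral is the change of a function on `Γ`. -/
theorem exists_potential : ∃ A : G.Curve → G.Jacobian, ∀ (x y : G.Curve) (P : G.Path x y),
    (QuotientAddGroup.mk P.integral : G.Jacobian) = A y - A x := by
  obtain ⟨v⟩ := G.nonempty
  choose c hc hb using G.exists_chain v
  let A : G.Curve → G.Jacobian := Quot.lift
    (Sum.elim (fun w => QuotientAddGroup.mk (G.integral (c w)))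
      fun q => QuotientAddGroup.mk (G.integral (c (G.tail q.1)) + G.moveIntegral q.1 0 q.2))
    (by
      rintro _ _ (e | e)
      · simp [moveIntegral]
      · refine QuotientAddGroup.eq.2 (AddSubgroup.mem_map.2
          ⟨c (G.head e) - (c (G.tail e) + edgeChain e), ⟨?_, fun e' => ?_⟩, ?_⟩)
        · refine LinearMap.mem_ker.2 ?_
          rw [map_sub, map_add, hb, hb, boundary_edgeChain]
          abel
        · classical
          obtain ⟨m, hm⟩ := hc (G.head e) e'
          obtain ⟨n, hn⟩ := hc (G.tail e) e'
          exact ⟨m - (n + if e' = e then 1 else 0),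
            by simp [hm, hn, edgeChain, Pi.single_apply]⟩
        · change G.integral _ = _
          rw [map_sub, map_add, integral_edgeChain]
          abel)
  refine ⟨A, fun x y P => ?_⟩
  induction P with
  | nil => simp [Path.integral]
  | cons e s t P ih =>
    rw [Path.integral, QuotientAddGroup.mk_add, ih]
    have h : A (G.point e t) = A (G.point e s) + QuotientAddGroup.mk (G.moveIntegral e s t) := by
      change QuotientAddGroup.mk _ = QuotientAddGroup.mk _ + QuotientAddGroup.mk _
      rw [← QuotientAddGroup.mk_add, add_assoc, moveIntegral_add]
    rw [h]
    abel

/-- The Abel-Jacobi map can be computed with any path. -/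
theorem abelJacobi_eq {p q : G.Curve} (P : G.Path p q) :
    G.abelJacobi p q = QuotientAddGroup.mk P.integral := by
  obtain ⟨A, hA⟩ := G.exists_potential
  rw [abelJacobi, hA, hA]

end WeightedGraph

/-! Lifted to `Ω(Γ)*`, the Abel-Jacobi map runs through a segment `e` along a straight line with
total displacement `∫_e`, whose norm is `F(e)`. A nonzero integral cycle has sup-norm at least `1`,
so the quotient map to the Jacobian preserves distances up to `1/2` and separates points at distance
less than `1`. Since `F(e) ≤ 1`, halving the line shows that both the curve and its image have
length `F(e)`; only the two ends can meet, and only if `F(e) = 1`.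

The Foster coefficients are controlled by cuts. The chain `b = e - π(e)` is orthogonal to all
cycles, hence a gradient, and the level sets of its potential give cuts that `b` crosses in one
direction only (`exists_cut`). The cycle `π(e)` has no net flow through a cut, so `b` has the flow
of `e`, which is at most `1`. It follows that `π(e)` attains its sup-norm at `e` itself: `F(e)` is a
diagonal entry of `π`, and the `F(e)` add up to the trace of `π`, the dimension of the cycle space,
which is `g`. If `F(e) = 1`, then `b = 0`, so `e` is a cycle, that is, a loop.

For the length of the whole image, distinct segments must have images with null intersection. If
interior points of `e` and `e'` have the same image, a chain joining them, corrected by an integral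
cycle, is orthogonal to all cycles; its almost integral coefficients leave room for no edge but `e`
in a suitable cut. So `e` is a bridge, `F(e) = 0`, and its image is null
(`foster_eq_zero_of_abelJacobi_eq`). -/

namespace WeightedGraph

variable {V E : Type*} (G : WeightedGraph V E)

/-! ### Chains, potentials and cuts -/

/-- The coboundary of a `0`-cochain. -/
def coboundary (h : V → ℝ) (e : E) : ℝ := h (G.head e) - h (G.tail e)

/-- Only the edge set is assumed finite. By connectedness, every vertex other than a fixed one is an
endpoint of an edge. -/
theorem finite_vertices {V E : Type*} (G : WeightedGraph V E) [Finite E] : Finite V := by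
  obtain ⟨v⟩ := G.nonempty
  refine Set.finite_univ_iff.1 (((Set.finite_singleton v).union
    ((Set.finite_range G.head).union (Set.finite_range G.tail))).subset fun w _ => ?_)
  rcases (G.connected v w).cases_tail with h | ⟨u, -, e, ⟨-, h⟩ | ⟨h, -⟩⟩
  · exact Or.inl h
  · exact Or.inr (Or.inl ⟨e, h⟩)
  · exact Or.inr (Or.inr ⟨e, h⟩)

/-- A function with values `0` and `1` encodes a cut: its coboundary is supported on the crossing
edges, with the direction of crossing as sign. -/
theorem abs_coboundary_of_ne {h : V → ℝ} (hh : ∀ v, h v = 0 ∨ h v = 1) {e : E}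
    (he : G.coboundary h e ≠ 0) : |G.coboundary h e| = 1 := by
  unfold coboundary at *
  rcases hh (G.head e) with h1 | h1 <;> rcases hh (G.tail e) with h2 | h2 <;> simp_all

theorem edgeChain_self (e : E) : edgeChain e e = 1 := by simp [edgeChain]

theorem edgeChain_of_ne {e x : E} (h : x ≠ e) : edgeChain e x = 0 := by simp [edgeChain, h]

variable [Fintype E]

/-- Summation by parts: the edge terms are regrouped by head and by tail. -/
theorem sum_mul_coboundary [Fintype V] (α : E → ℝ) (h : V → ℝ) :
    ∑ e, α e * G.coboundary h e = ∑ v, G.boundary α v * h v := by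
  classical
  have key : ∀ f : E → V, ∑ e, α e * h (f e) = ∑ v, (∑ e with f e = v, α e) * h v := by
    intro f
    rw [← Finset.sum_fiberwise Finset.univ f]
    refine Finset.sum_congr rfl fun v _ => ?_
    rw [Finset.sum_mul]
    refine Finset.sum_congr rfl fun e he => ?_
    rw [(Finset.mem_filter.1 he).2]
  simp only [coboundary, mul_sub, Finset.sum_sub_distrib, key]
  rw [← Finset.sum_sub_distrib]
  refine Finset.sum_congr rfl fun v _ => ?_
  rw [← sub_mul]
  simp only [boundary, LinearMap.coe_mk, AddHom.coe_mk]

theorem sum_mul_coboundary_of_mem_cycles {γ : E → ℝ} (hγ : γ ∈ G.cycles) (h : V → ℝ) :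
    ∑ e, γ e * G.coboundary h e = 0 := by
  have := G.finite_vertices
  have := Fintype.ofFinite V
  rw [sum_mul_coboundary, show G.boundary γ = 0 from hγ]
  simp

theorem sum_edgeChain_mul (e : E) (f : E → ℝ) : ∑ x, edgeChain e x * f x = f e := by
  rw [Finset.sum_eq_single e (fun x _ hx => by rw [edgeChain_of_ne hx, zero_mul]) (by simp),
    edgeChain_self, one_mul]

theorem chainInner_edgeChain (e : E) (α : E → ℝ) :
    G.chainInner (edgeChain e) α = α e * G.len e := by
  simp [chainInner_apply, mul_assoc, sum_edgeChain_mul e fun x => α x * G.len x]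

/-- A chain that is orthogonal to all cycles is the gradient of a potential. -/
theorem exists_potential_of_orthogonal {a : E → ℝ}
    (ha : ∀ γ ∈ G.cycles, G.chainInner γ a = 0) :
    ∃ f : V → ℝ, ∀ e, a e * G.len e = G.coboundary f e := by
  obtain ⟨v⟩ := G.nonempty
  choose c _ hb using G.exists_chain v
  refine ⟨fun w => G.chainInner (c w) a, fun e => ?_⟩
  -- The edge `e` is closed up to a cycle by the chains from `v` to its two ends.
  have h := ha (c (G.head e) - c (G.tail e) - edgeChain e) (LinearMap.mem_ker.2 (by
    rw [map_sub, map_sub, hb, hb, boundary_edgeChain]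
    abel))
  rw [map_sub, map_sub, LinearMap.sub_apply, LinearMap.sub_apply, chainInner_edgeChain] at h
  rw [coboundary]
  linarith

/-- The level sets of a potential of `a`: every edge at which `a` does not vanish is crossed by a cut
that `a` crosses in one direction only. -/
theorem exists_cut {a : E → ℝ} (ha : ∀ γ ∈ G.cycles, G.chainInner γ a = 0) {x : E}
    (hx : a x ≠ 0) : ∃ h : V → ℝ, (∀ v, h v = 0 ∨ h v = 1) ∧
      (∀ e, a e * G.coboundary h e = |a e| * |G.coboundary h e|) ∧
      (∀ e, G.coboundary h e ≠ 0 → a e ≠ 0) ∧ G.coboundary h x ≠ 0 := by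
  classical
  obtain ⟨f, hf⟩ := G.exists_potential_of_orthogonal ha
  have pos := G.len_pos
  have hx' : f (G.head x) ≠ f (G.tail x) := fun h => by
    have := hf x
    rw [coboundary, h, sub_self] at this
    exact (mul_ne_zero hx (pos x).ne') this
  -- The set where `f` exceeds the lower of its two values at the ends of `x` separates these ends.
  -- Every edge that enters this set has increasing `f`, which fixes the sign of `a` there.
  let c := min (f (G.head x)) (f (G.tail x))
  refine ⟨fun v => if c < f v then 1 else 0, fun v => ?_, fun e => ?_, fun e he h0 => ?_, ?_⟩
  · dsimp only
    split_ifs <;> simp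
  · have h := hf e
    unfold coboundary at h ⊢
    dsimp only
    split_ifs with h1 h2 h2
    · simp
    · have : 0 < a e := pos_of_mul_pos_left (by rw [h]; linarith) (pos e).le
      simp [abs_of_pos this]
    · have : a e < 0 := by
        by_contra! h3
        have := mul_nonneg h3 (pos e).le
        linarith
      simp [abs_of_neg this]
    · simp
  · have h := hf e
    rw [h0, zero_mul, coboundary, eq_comm, sub_eq_zero] at h
    exact he (by simp [coboundary, h])
  · unfold coboundary
    rcases lt_or_gt_of_ne hx' with h | h
    · simp [c, h, h.le]
    · simp [c, h, h.le]

/-! ### The Foster coefficients -/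

theorem sub_proj_orthogonal (α : E → ℝ) :
    ∀ γ ∈ G.cycles, G.chainInner γ (α - G.proj α) = 0 :=
  fun _ hγ => G.chainInner_sub_proj α hγ

/-- The part of an edge `e` orthogonal to the cycles has the boundary of `e`, and is therefore at
most `1` on `e` and any other edge together. -/
theorem sub_proj_edgeChain_bounds (e x : E) (hx : (edgeChain e - G.proj (edgeChain e)) x ≠ 0) :
    0 < (edgeChain e - G.proj (edgeChain e)) e ∧ (edgeChain e - G.proj (edgeChain e)) e ≤ 1 ∧
      (x ≠ e → |(edgeChain e - G.proj (edgeChain e)) x| +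
        (edgeChain e - G.proj (edgeChain e)) e ≤ 1) := by
  set b := edgeChain e - G.proj (edgeChain e) with hb
  obtain ⟨h, hh, h1, h2, h3⟩ := G.exists_cut (G.sub_proj_orthogonal (edgeChain e)) hx
  rw [← hb] at h1 h2
  have hnn : ∀ y, 0 ≤ b y * G.coboundary h y := fun y => by
    rw [h1 y]; positivity
  -- The cycle `π(e)` has zero net flow through the cut, so `b` has the flow of `e`. As all terms
  -- are nonnegative, each of them, or the sum of two, is bounded by this flow.
  have hsum : ∑ y, b y * G.coboundary h y = G.coboundary h e := by
    simp only [hb, Pi.sub_apply, sub_mul, Finset.sum_sub_distrib]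
    rw [sum_edgeChain_mul, G.sum_mul_coboundary_of_mem_cycles (G.proj_mem _), sub_zero]
  have hle : ∀ y, b y * G.coboundary h y ≤ G.coboundary h e := fun y => by
    rw [← hsum]
    exact Finset.single_le_sum (f := fun y => b y * G.coboundary h y) (fun y _ => hnn y)
      (Finset.mem_univ y)
  have hbx : b x * G.coboundary h x = |b x| := by
    rw [h1, G.abs_coboundary_of_ne hh h3, mul_one]
  have hpos : 0 < G.coboundary h e :=
    lt_of_lt_of_le (by rw [hbx]; exact abs_pos.2 hx) (hle x)
  have he1 : G.coboundary h e = 1 := by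
    rw [← G.abs_coboundary_of_ne hh hpos.ne', abs_of_pos hpos]
  have hbe : b e = |b e| := by
    have := h1 e
    rwa [he1, abs_one, mul_one, mul_one] at this
  have hbe' : 0 < b e := by
    rw [hbe]
    exact abs_pos.2 (h2 e hpos.ne')
  refine ⟨hbe', ?_, fun hxe => ?_⟩
  · simpa [he1] using hle e
  · have := Finset.add_le_sum (f := fun y => b y * G.coboundary h y) (s := Finset.univ)
      (fun y _ => hnn y) (Finset.mem_univ x) (Finset.mem_univ e) hxe
    rwa [hsum, hbx, he1, mul_one] at this

theorem sub_proj_edgeChain_self_bounds (e : E) :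
    0 ≤ (edgeChain e - G.proj (edgeChain e)) e ∧
      (edgeChain e - G.proj (edgeChain e)) e ≤ 1 := by
  by_cases h : (edgeChain e - G.proj (edgeChain e)) e = 0
  · rw [h]; norm_num
  · exact ⟨(G.sub_proj_edgeChain_bounds e e h).1.le, (G.sub_proj_edgeChain_bounds e e h).2.1⟩

theorem proj_edgeChain_self_nonneg (e : E) : 0 ≤ G.proj (edgeChain e) e := by
  have := (G.sub_proj_edgeChain_self_bounds e).2
  rw [Pi.sub_apply, edgeChain_self] at this
  linarith

/-- By the cut bound, `|π(e)(x)| ≤ 1 - b(e) = π(e)(e)` for each `x ≠ e` with `b(x) ≠ 0`, where `b =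
e - π(e)`. Thus the supremum is a diagonal entry of `π`. -/
theorem foster_eq (e : E) : G.foster e = G.proj (edgeChain e) e := by
  have h0 := G.proj_edgeChain_self_nonneg e
  refine le_antisymm (Real.iSup_le (fun x => ?_) h0) ((le_abs_self _).trans (abs_le_supNorm _ e))
  rcases eq_or_ne x e with rfl | hx
  · rw [abs_of_nonneg h0]
  · by_cases h : (edgeChain e - G.proj (edgeChain e)) x = 0
    · have : G.proj (edgeChain e) x = 0 := by simpa [edgeChain_of_ne hx] using h
      rwa [this, abs_zero]
    · have := (G.sub_proj_edgeChain_bounds e x h).2.2 hx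
      simp only [Pi.sub_apply, edgeChain_self] at this
      rw [edgeChain_of_ne hx, zero_sub, abs_neg] at this
      linarith

theorem foster_nonneg (e : E) : 0 ≤ G.foster e := supNorm_nonneg _

theorem foster_le_one (e : E) : G.foster e ≤ 1 := by
  have := (G.sub_proj_edgeChain_self_bounds e).1
  rw [Pi.sub_apply, edgeChain_self] at this
  rw [foster_eq]
  linarith

theorem edgeChain_mem_cycles_iff (e : E) : edgeChain e ∈ G.cycles ↔ G.tail e = G.head e := by
  classical
  rw [cycles, LinearMap.mem_ker, boundary_edgeChain, sub_eq_zero]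
  refine ⟨fun h => ?_, fun h => by rw [h]⟩
  have := congrFun h (G.head e)
  by_contra hne
  simp [Ne.symm hne] at this

/-- If `e - π(e)` were nonzero at any edge, it would be positive at `e`, forcing `F(e) < 1`. -/
theorem foster_eq_one_iff (e : E) : G.foster e = 1 ↔ G.tail e = G.head e := by
  rw [← edgeChain_mem_cycles_iff]
  refine ⟨fun h => ?_, fun h => ?_⟩
  · have h0 : (edgeChain e - G.proj (edgeChain e)) e = 0 := by
      rw [Pi.sub_apply, edgeChain_self, ← foster_eq, h, sub_self]
    have : edgeChain e - G.proj (edgeChain e) = 0 := funext fun x => by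
      by_contra hx
      exact (G.sub_proj_edgeChain_bounds e x hx).1.ne' h0
    rw [sub_eq_zero.1 this]
    exact G.proj_mem _
  · rw [foster_eq, G.proj_of_mem_cycles h, edgeChain_self]

/-- The Foster coefficient of a bridge vanishes. -/
theorem foster_eq_zero_of_cut {e : E} {h : V → ℝ} (he : G.coboundary h e ≠ 0)
    (hh : ∀ x, x ≠ e → G.coboundary h x = 0) : G.foster e = 0 := by
  have := G.sum_mul_coboundary_of_mem_cycles (G.proj_mem (edgeChain e)) h
  rw [Finset.sum_eq_single e (fun x _ hx => by rw [hh x hx, mul_zero]) (by simp)] at this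
  rw [foster_eq]
  exact (mul_eq_zero.1 this).resolve_right he

/-! ### The genus -/

theorem span_intCycles : Submodule.span ℝ (G.intCycles : Set (E → ℝ)) = G.cycles := by
  refine le_antisymm (Submodule.span_le.2 fun γ hγ => hγ.1) fun γ hγ => ?_
  obtain ⟨v⟩ := G.nonempty
  choose c hc hb using G.exists_chain v
  -- Each edge is closed up through `v` to an integral cycle. Weighted by the coefficients of `γ`,
  -- the added chains cancel, because `γ` pairs to zero with every coboundary.
  have key : γ = ∑ e, γ e • (edgeChain e - (c (G.head e) - c (G.tail e))) := by
    funext x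
    have h := G.sum_mul_coboundary_of_mem_cycles hγ fun w => c w x
    simp only [coboundary] at h
    simp only [Finset.sum_apply, Pi.smul_apply, Pi.sub_apply, smul_eq_mul]
    simp only [mul_sub (γ _) (edgeChain _ x), Finset.sum_sub_distrib, h, sub_zero]
    rw [Finset.sum_eq_single x (fun e _ he => by rw [edgeChain_of_ne he.symm, mul_zero]) (by simp),
      edgeChain_self, mul_one]
  rw [key]
  refine Submodule.sum_mem _ fun e _ => Submodule.smul_mem _ _ (Submodule.subset_span ⟨?_, ?_⟩)
  · refine LinearMap.mem_ker.2 ?_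
    rw [map_sub, map_sub, hb, hb, boundary_edgeChain]
    abel
  · intro x
    classical
    obtain ⟨m, hm⟩ := hc (G.head e) x
    obtain ⟨n, hn⟩ := hc (G.tail e) x
    exact ⟨(if x = e then 1 else 0) - (m - n), by simp [hm, hn, edgeChain, Pi.single_apply]⟩

/-- Distinct integral chains are at sup-distance at least `1`, so the integral cycles are a discrete
subgroup; its rank is the dimension of its real span. -/
theorem genus_eq_finrank_cycles : G.genus = Module.finrank ℝ G.cycles := by
  have hspan : Submodule.span ℤ (G.intCycles : Set (E → ℝ)) =
      AddSubgroup.toIntSubmodule G.intCycles :=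
    Submodule.span_eq (AddSubgroup.toIntSubmodule G.intCycles)
  have hd : DiscreteTopology (Submodule.span ℤ (G.intCycles : Set (E → ℝ))) := by
    rw [hspan]
    refine DiscreteTopology.of_forall_le_dist one_pos fun α β hne => ?_
    obtain ⟨e, he⟩ := Function.ne_iff.1 (fun h => hne (Subtype.ext h) : (α : E → ℝ) ≠ β)
    obtain ⟨m, hm⟩ := α.2.2 e
    obtain ⟨n, hn⟩ := β.2.2 e
    refine le_trans ?_ (dist_le_pi_dist (α : E → ℝ) β e)
    rw [hm, hn] at he ⊢
    rw [Real.dist_eq]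
    exact_mod_cast Int.one_le_abs (sub_ne_zero.2 (by exact_mod_cast he))
  have h := Real.finrank_eq_int_finrank_of_discrete hd
  rw [Set.finrank, Set.finrank, span_intCycles, hspan] at h
  rw [h]
  rfl

/-- Foster's theorem: both sides are the trace of the projection `π`. -/
theorem sum_foster : ∑ e, G.foster e = G.genus := by
  classical
  have h : LinearMap.IsProj G.cycles G.proj := ⟨G.proj_mem, fun _ h => G.proj_of_mem_cycles h⟩
  have ht := h.trace
  rw [genus_eq_finrank_cycles, ← ht, LinearMap.trace_eq_matrix_trace ℝ (Pi.basisFun ℝ E),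
    Matrix.trace]
  refine Finset.sum_congr rfl fun e _ => ?_
  rw [foster_eq, Matrix.diag_apply, LinearMap.toMatrix_apply]
  simp [edgeChain]

end WeightedGraph

namespace WeightedGraph

/-! ### Curves of unit speed -/

theorem hausdorffMeasure_image_Icc_of_isometry {X : Type*} [MetricSpace X] [MeasurableSpace X]
    [BorelSpace X] {σ : ℝ → X} {a b : ℝ}
    (h : ∀ u ∈ Icc a b, ∀ v ∈ Icc a b, dist (σ u) (σ v) = |u - v|) :
    μH[1] (σ '' Icc a b) = ENNReal.ofReal (b - a) := by
  have h1 : Isometry fun u : Icc a b => σ u := Isometry.of_dist_eq fun u v => by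
    rw [h u u.2 v v.2, Subtype.dist_eq, Real.dist_eq]
  have h2 := h1.hausdorffMeasure_image (d := 1) (Or.inl zero_le_one) univ
  have h3 := (isometry_subtype_coe (s := Icc a b)).hausdorffMeasure_image (d := 1)
    (Or.inl zero_le_one) univ
  rw [image_univ, Subtype.range_coe, hausdorffMeasure_real, Real.volume_Icc] at h3
  rw [h3, ← h2, image_univ, ← image_eq_range]

/-- The length of the image of a curve of unit speed that is injective up to its endpoints. -/
theorem hausdorffMeasure_image_Icc_of_local_isometry {X : Type*} [MetricSpace X]
    [MeasurableSpace X] [BorelSpace X] {σ : ℝ → X} {L : ℝ} (h0 : 0 ≤ L) (h1 : L ≤ 1)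
    (hdist : ∀ u v, |u - v| ≤ 1 / 2 → dist (σ u) (σ v) = |u - v|)
    (hinj : ∀ u v, |u - v| < 1 → σ u = σ v → u = v) :
    μH[1] (σ '' Icc 0 L) = ENNReal.ofReal L := by
  have half : ∀ a b : ℝ, b - a ≤ 1 / 2 → ∀ u ∈ Icc a b, ∀ v ∈ Icc a b,
      dist (σ u) (σ v) = |u - v| := fun a b hab u hu v hv =>
    hdist u v (abs_le.2 ⟨by linarith [hu.1, hv.2], by linarith [hu.2, hv.1]⟩)
  have hl := half 0 (L / 2) (by linarith)
  have hr := half (L / 2) L (by linarith)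
  have hcompact : IsCompact (σ '' Icc (L / 2) L) := isCompact_Icc.image_of_continuousOn
    (LipschitzOnWith.of_dist_le_mul (K := 1) fun u hu v hv => by
      rw [hr u hu v hv, NNReal.coe_one, one_mul, Real.dist_eq]).continuousOn
  have := Measure.nullSingletonClass_hausdorff X one_pos
  -- The images of the two halves meet at the midpoint and, when `L = 1`, possibly where the curve
  -- closes up.
  have hinter : μH[1] (σ '' Icc 0 (L / 2) ∩ σ '' Icc (L / 2) L) = 0 := by
    refine measure_mono_null (t := {σ (L / 2), σ 0}) ?_
      ((Set.toFinite _).countable.measure_zero _)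
    rintro _ ⟨⟨u, hu, rfl⟩, v, hv, huv⟩
    by_cases hlt : |v - u| < 1
    · have := hinj v u hlt huv
      have : u = L / 2 := le_antisymm hu.2 (this ▸ hv.1)
      simp [this]
    · rw [abs_of_nonneg (by linarith [hu.2, hv.1]), not_lt] at hlt
      have : u = 0 := le_antisymm (by linarith [hv.2]) hu.1
      simp [this]
  have h := measure_union_add_inter (μ := (μH[1] : Measure X)) (σ '' Icc 0 (L / 2))
    hcompact.measurableSet
  rw [hinter, add_zero, hausdorffMeasure_image_Icc_of_isometry hl,
    hausdorffMeasure_image_Icc_of_isometry hr, ← image_union,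
    Icc_union_Icc_eq_Icc (by linarith) (by linarith),
    ← ENNReal.ofReal_add (by linarith) (by linarith)] at h
  rw [h]
  congr 1
  ring

variable {V E : Type*} (G : WeightedGraph V E) [Fintype E]

/-! ### The metric of the Jacobian -/

theorem norm_smul_harmonicDual (c : ℝ) (s : G.HarmonicDual) : ‖c • s‖ = |c| * ‖s‖ :=
  G.fosterNorm_smul c s

theorem moveIntegral_eq_smul (e : E) (s t : ℝ) :
    G.moveIntegral e s t = ((t - s) / G.len e) • G.integral (edgeChain e) := by
  rw [integral_edgeChain, moveIntegral, moveIntegral, sub_zero, smul_smul,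
    div_mul_cancel₀ _ (G.len_pos e).ne']

theorem norm_integral_edgeChain (e : E) : ‖G.integral (edgeChain e)‖ = G.foster e :=
  G.norm_integral _

theorem one_le_norm_of_mem_periods {s : G.HarmonicDual} (hs : s ∈ G.periods) (h0 : s ≠ 0) :
    1 ≤ ‖s‖ := by
  obtain ⟨α, hα, h⟩ := AddSubgroup.mem_map.1 hs
  replace h : G.integral α = s := h
  have hne : α ≠ 0 := by
    rintro rfl
    exact h0 (by rw [← h, map_zero])
  obtain ⟨e, he⟩ := Function.ne_iff.1 hne
  rw [← h, norm_integral, proj_of_mem_cycles _ hα.1]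
  refine le_trans ?_ (abs_le_supNorm α e)
  obtain ⟨n, hn⟩ := hα.2 e
  rw [hn] at he ⊢
  exact_mod_cast Int.one_le_abs (by simpa using he)

/-- The class of a functional in the Jacobian. -/
noncomputable abbrev toJacobian (s : G.HarmonicDual) : G.Jacobian := QuotientAddGroup.mk s

/-- Any other representative differs from `s` by a period of norm at least `1`, so its norm is at
least `1/2`. -/
theorem norm_toJacobian {s : G.HarmonicDual} (hs : ‖s‖ ≤ 1 / 2) : ‖G.toJacobian s‖ = ‖s‖ := by
  refine le_antisymm QuotientAddGroup.norm_mk_le_norm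
    (QuotientAddGroup.le_norm_iff.2 fun m hm => ?_)
  have h : -m + s ∈ G.periods := QuotientAddGroup.eq.1 hm
  by_cases h0 : -m + s = 0
  · rw [neg_add_eq_zero.1 h0]
  · have h1 := G.one_le_norm_of_mem_periods h h0
    have h2 := norm_add_le (-m) s
    rw [norm_neg] at h2
    linarith

theorem toJacobian_eq_iff {s t : G.HarmonicDual} :
    G.toJacobian s = G.toJacobian t ↔ t - s ∈ G.periods := by
  rw [toJacobian, toJacobian, QuotientAddGroup.eq, neg_add_eq_sub]

theorem eq_of_toJacobian_eq {s t : G.HarmonicDual} (h : G.toJacobian s = G.toJacobian t)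
    (hst : ‖t - s‖ < 1) : s = t := by
  by_contra hne
  exact not_le.2 hst (G.one_le_norm_of_mem_periods (G.toJacobian_eq_iff.1 h)
    (sub_ne_zero.2 (Ne.symm hne)))

/-! ### The Abel-Jacobi map on a segment -/

theorem abelJacobi_point (p : G.Curve) (e : E) (s t : Icc (0 : ℝ) (G.len e)) :
    G.abelJacobi p (G.point e t) =
      G.abelJacobi p (G.point e s) + G.toJacobian (G.moveIntegral e s t) := by
  rw [G.abelJacobi_eq (.cons e s t (G.exists_path p (G.point e s)).some)]
  rfl

/-- On a segment the map is the projection of a straight line in the direction `∫_e`. -/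
theorem abelJacobi_point_eq (p : G.Curve) (e : E) (t : Icc (0 : ℝ) (G.len e)) :
    G.abelJacobi p (G.point e t) = G.abelJacobi p (G.vertex (G.tail e)) +
      G.toJacobian (((t : ℝ) / G.len e) • G.integral (edgeChain e)) := by
  rw [← point_zero, G.abelJacobi_point p e ⟨0, G.zero_mem_Icc e⟩ t, moveIntegral_eq_smul]
  simp

theorem abelJacobi_segment (p : G.Curve) (e : E) :
    G.abelJacobi p '' G.segment e = (fun u : ℝ => G.abelJacobi p (G.vertex (G.tail e)) +
      G.toJacobian (u • G.integral (edgeChain e))) '' Icc 0 1 := by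
  have hl := G.len_pos e
  ext y
  constructor
  · rintro ⟨_, ⟨t, rfl⟩, rfl⟩
    exact ⟨t / G.len e, ⟨div_nonneg t.2.1 hl.le, (div_le_one hl).2 t.2.2⟩,
      (G.abelJacobi_point_eq p e t).symm⟩
  · rintro ⟨u, hu, rfl⟩
    refine ⟨_, ⟨⟨u * G.len e, mul_nonneg hu.1 hl.le, mul_le_of_le_one_left hl.le hu.2⟩, rfl⟩, ?_⟩
    rw [abelJacobi_point_eq]
    simp [hl.ne']

theorem dist_add_toJacobian (x : G.Jacobian) (s t : G.HarmonicDual) :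
    dist (x + G.toJacobian s) (x + G.toJacobian t) = ‖G.toJacobian (s - t)‖ := by
  rw [dist_add_left, dist_eq_norm]
  rfl

theorem hausdorffMeasure_abelJacobi_segment (p : G.Curve) (e : E) :
    μH[1] (G.abelJacobi p '' G.segment e) = ENNReal.ofReal (G.foster e) := by
  rw [abelJacobi_segment]
  set x := G.abelJacobi p (G.vertex (G.tail e))
  set w := G.integral (edgeChain e)
  have hw : ‖w‖ = G.foster e := G.norm_integral_edgeChain e
  rcases (G.foster_nonneg e).eq_or_lt with hF | hF
  -- If `F(e) = 0`, the curve is constant; otherwise it is rescaled to unit speed on `[0, F(e)]`.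
  · have := Measure.nullSingletonClass_hausdorff G.Jacobian one_pos
    have hw0 : w = 0 := norm_eq_zero.1 (by rw [hw, ← hF])
    rw [← hF, ENNReal.ofReal_zero]
    refine measure_mono_null (t := {x}) ?_ (measure_singleton x)
    rintro _ ⟨u, -, rfl⟩
    simp [hw0]
  · have hnorm : ∀ u v : ℝ, ‖(u / G.foster e) • w - (v / G.foster e) • w‖ = |u - v| := fun u v => by
      rw [← sub_smul, norm_smul_harmonicDual, hw, ← sub_div, abs_div, abs_of_pos hF,
        div_mul_cancel₀ _ hF.ne']
    rw [← hausdorffMeasure_image_Icc_of_local_isometry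
      (σ := fun u : ℝ => x + G.toJacobian ((u / G.foster e) • w)) hF.le (G.foster_le_one e)]
    · congr 1
      ext y
      constructor
      · rintro ⟨u, hu, rfl⟩
        refine ⟨u * G.foster e, ⟨mul_nonneg hu.1 hF.le, mul_le_of_le_one_left hF.le hu.2⟩, ?_⟩
        simp only [mul_div_cancel_right₀ _ hF.ne']
      · rintro ⟨u, hu, rfl⟩
        exact ⟨u / G.foster e, ⟨div_nonneg hu.1 hF.le, (div_le_one hF).2 hu.2⟩, rfl⟩
    · intro u v huv
      rw [dist_add_toJacobian, norm_toJacobian, hnorm]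
      rwa [hnorm]
    · intro u v huv h
      have h1 := G.eq_of_toJacobian_eq (add_left_cancel h) (by rw [hnorm, abs_sub_comm]; exact huv)
      have h2 := hnorm u v
      rw [h1, sub_self, norm_zero] at h2
      exact sub_eq_zero.1 (abs_eq_zero.1 h2.symm)

theorem dist_abelJacobi_point_le (p : G.Curve) (e : E) (s t : Icc (0 : ℝ) (G.len e)) :
    dist (G.abelJacobi p (G.point e s)) (G.abelJacobi p (G.point e t)) ≤
      G.foster e / G.len e * |(s : ℝ) - t| := by
  rw [abelJacobi_point_eq, abelJacobi_point_eq, dist_add_toJacobian]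
  refine QuotientAddGroup.norm_mk_le_norm.trans ?_
  rw [← sub_smul, norm_smul_harmonicDual, norm_integral_edgeChain, ← sub_div, abs_div,
    abs_of_pos (G.len_pos e)]
  exact le_of_eq (by ring)

theorem dist_abelJacobi_point_of_le (p : G.Curve) (e : E) (s t : Icc (0 : ℝ) (G.len e))
    (h : |(s : ℝ) - t| ≤ G.len e / 2) :
    dist (G.abelJacobi p (G.point e s)) (G.abelJacobi p (G.point e t)) =
      G.foster e / G.len e * |(s : ℝ) - t| := by
  have hl := G.len_pos e
  have hn : ‖((s : ℝ) / G.len e) • G.integral (edgeChain e) -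
      ((t : ℝ) / G.len e) • G.integral (edgeChain e)‖ = G.foster e / G.len e * |(s : ℝ) - t| := by
    rw [← sub_smul, norm_smul_harmonicDual, norm_integral_edgeChain, ← sub_div, abs_div,
      abs_of_pos hl]
    ring
  rw [abelJacobi_point_eq, abelJacobi_point_eq, dist_add_toJacobian, norm_toJacobian, hn]
  rw [hn]
  calc G.foster e / G.len e * |(s : ℝ) - t| ≤ 1 / G.len e * (G.len e / 2) := by
        gcongr
        exact G.foster_le_one e
    _ = 1 / 2 := by field_simp

theorem eVariationOn_abelJacobi_point (p : G.Curve) (e : E) :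
    eVariationOn (fun t => G.abelJacobi p (G.point e t)) univ = ENNReal.ofReal (G.foster e) := by
  have hl := G.len_pos e
  have hF := G.foster_nonneg e
  set f := fun t => G.abelJacobi p (G.point e t) with hf
  let a : Icc (0 : ℝ) (G.len e) := ⟨0, G.zero_mem_Icc e⟩
  let m : Icc (0 : ℝ) (G.len e) := ⟨G.len e / 2, by linarith, by linarith⟩
  let b : Icc (0 : ℝ) (G.len e) := ⟨G.len e, G.len_mem_Icc e⟩
  apply le_antisymm
  · have hlip : LipschitzOnWith (G.foster e / G.len e).toNNReal f univ :=
      LipschitzOnWith.of_dist_le_mul fun s _ t _ => by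
        rw [Real.coe_toNNReal _ (div_nonneg hF hl.le), Subtype.dist_eq, Real.dist_eq]
        exact G.dist_abelJacobi_point_le p e s t
    have h1 := hlip.comp_eVariationOn_le (g := id) (s := univ) (mapsTo_univ _ _)
    have hmono : MonotoneOn (Subtype.val : Icc (0 : ℝ) (G.len e) → ℝ) univ :=
      fun s _ t _ h => h
    have h2 := (hmono.eVariationOn_eq (mem_univ a) (mem_univ b)).le
    have h3 : (univ : Set (Icc (0 : ℝ) (G.len e))) ∩ Icc a b = univ := by
      rw [univ_inter]
      exact eq_univ_of_forall fun t => ⟨t.2.1, t.2.2⟩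
    rw [h3] at h2
    calc eVariationOn f univ ≤ _ := h1
      _ = (G.foster e / G.len e).toNNReal *
          eVariationOn (Subtype.val : Icc (0 : ℝ) (G.len e) → ℝ) univ := rfl
      _ ≤ ENNReal.ofReal (G.foster e / G.len e) * ENNReal.ofReal (G.len e - 0) := by
        gcongr
        exact le_rfl
      _ = _ := by
        rw [← ENNReal.ofReal_mul (div_nonneg hF hl.le), sub_zero, div_mul_cancel₀ _ hl.ne']
  -- The partition into two halves suffices: on each of them the distance in the Jacobian is that of
  -- the straight line.
  · have key : ∀ s t : Icc (0 : ℝ) (G.len e), |(s : ℝ) - t| = G.len e / 2 →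
        edist (f s) (f t) = ENNReal.ofReal (G.foster e / 2) := fun s t h => by
      rw [edist_dist, G.dist_abelJacobi_point_of_le p e s t h.le, h]
      congr 1
      field_simp
    have ham : a ≤ m := m.2.1
    have hmb : m ≤ b := m.2.2
    have h1 : edist (f a) (f m) ≤ eVariationOn f (univ ∩ Icc a m) :=
      eVariationOn.edist_le f ⟨mem_univ _, le_rfl, ham⟩ ⟨mem_univ _, ham, le_rfl⟩
    have h2 : edist (f m) (f b) ≤ eVariationOn f (univ ∩ Icc m b) :=
      eVariationOn.edist_le f ⟨mem_univ _, le_rfl, hmb⟩ ⟨mem_univ _, hmb, le_rfl⟩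
    rw [key a m (by simp only [a, m]; rw [zero_sub, abs_neg, abs_of_pos (by linarith)])] at h1
    rw [key m b (by
      simp only [m, b]
      rw [abs_sub_comm, abs_of_pos (by linarith)]
      ring)] at h2
    calc ENNReal.ofReal (G.foster e) =
        ENNReal.ofReal (G.foster e / 2) + ENNReal.ofReal (G.foster e / 2) := by
          rw [← ENNReal.ofReal_add (by linarith) (by linarith), add_halves]
      _ ≤ _ := add_le_add h1 h2
      _ = _ := eVariationOn.Icc_add_Icc f ham hmb (mem_univ m)
      _ ≤ _ := eVariationOn.mono f (subset_univ _)

end WeightedGraph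

namespace WeightedGraph

variable {V E : Type*} (G : WeightedGraph V E)

/-! ### Segments of the tropical curve -/

theorem eq_or_endpoint_of_point_eq {e e' : E} {s : Icc (0 : ℝ) (G.len e)}
    {t : Icc (0 : ℝ) (G.len e')} (h : G.point e s = G.point e' t) :
    e = e' ∨ (t : ℝ) = 0 ∨ (t : ℝ) = G.len e' := by
  -- Being an interior point of `e'` is compatible with the gluing, which only involves endpoints
  -- and vertices.
  let I : G.Curve → Prop := Quot.lift
    (Sum.elim (fun _ => False) fun q => q.1 = e' ∧ 0 < (q.2 : ℝ) ∧ (q.2 : ℝ) < G.len q.1)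
    (by rintro _ _ (x | x) <;> simp)
  by_contra! hne
  have h1 : I (G.point e' t) :=
    ⟨rfl, lt_of_le_of_ne t.2.1 (Ne.symm hne.2.1), lt_of_le_of_ne t.2.2 hne.2.2⟩
  rw [← h] at h1
  exact hne.1 h1.1

theorem continuous_point (e : E) : Continuous (G.point e) :=
  continuous_iff_coinduced_le.2 (le_iSup (fun e =>
    TopologicalSpace.coinduced (G.point e) inferInstance) e)

theorem finite_endpoints (e : E) :
    {t : Icc (0 : ℝ) (G.len e) | (t : ℝ) = 0 ∨ (t : ℝ) = G.len e}.Finite := by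
  refine ((Set.finite_singleton ⟨0, G.zero_mem_Icc e⟩).insert
    ⟨G.len e, G.len_mem_Icc e⟩).subset ?_
  rintro t (h | h)
  · exact Or.inr (Subtype.ext h)
  · exact Or.inl (Subtype.ext h)

theorem preimage_segment_self (e : E) : G.point e ⁻¹' G.segment e = univ :=
  preimage_range _

theorem finite_preimage_segment {e e' : E} (h : e ≠ e') :
    (G.point e' ⁻¹' G.segment e).Finite :=
  (G.finite_endpoints e').subset fun _ ⟨_, hs⟩ =>
    (G.eq_or_endpoint_of_point_eq hs).resolve_left h

/-- Another segment meets `e` in endpoints only. Closedness makes the segment measurable for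
`zhangMeasure`. -/
theorem isClosed_segment (e : E) : IsClosed (G.segment e) := by
  refine isClosed_iSup_iff.2 fun e' => isClosed_coinduced.2 ?_
  rcases eq_or_ne e e' with rfl | h
  · rw [preimage_segment_self]
    exact isClosed_univ
  · exact (G.finite_preimage_segment h).isClosed

theorem univ_eq_vertices_union_segments :
    (univ : Set G.Curve) = range G.vertex ∪ ⋃ e, G.segment e := by
  refine (eq_univ_of_forall fun q => ?_).symm
  induction q using Quot.ind with
  | mk a =>
    rcases a with v | ⟨e, t⟩
    · exact Or.inl ⟨v, rfl⟩
    · exact Or.inr (mem_iUnion.2 ⟨e, t, rfl⟩)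

variable [Fintype E]

theorem zhangMeasure_segment (e : E) :
    G.zhangMeasure (G.segment e) = ENNReal.ofReal (G.foster e) := by
  have hl := G.len_pos e
  have hm := (G.isClosed_segment e).measurableSet
  have hcomap : ∀ (e' : E) (A : Set (Icc (0 : ℝ) (G.len e'))),
      Measure.comap Subtype.val volume A = volume (Subtype.val '' A) := fun e' A =>
    (MeasurableEmbedding.subtype_coe measurableSet_Icc).comap_apply _ _
  have hmap : ∀ e', Measure.map (G.point e') (Measure.comap Subtype.val volume) (G.segment e) =
      volume (Subtype.val '' (G.point e' ⁻¹' G.segment e)) := fun e' => by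
    rw [Measure.map_apply (G.continuous_point e').measurable hm, hcomap]
  rw [zhangMeasure, Measure.finsetSum_apply, Finset.sum_eq_single e]
  · rw [Measure.smul_apply, hmap, preimage_segment_self, image_univ, Subtype.range_coe,
      Real.volume_Icc, smul_eq_mul, ← ENNReal.ofReal_mul (div_nonneg (G.foster_nonneg e) hl.le),
      sub_zero, div_mul_cancel₀ _ hl.ne']
  · intro e' _ he'
    rw [Measure.smul_apply, hmap, ((G.finite_preimage_segment he'.symm).image _).measure_zero,
      smul_zero]
  · simp

/-! ### The images of distinct segments -/

/-- The Abel-Jacobi map at the vertices is given by integral chains. -/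
theorem exists_chain_abelJacobi (p : G.Curve) (v w : V) :
    ∃ c : E → ℝ, (∀ e, ∃ n : ℤ, c e = n) ∧
      (∀ h : V → ℝ, ∑ e, c e * G.coboundary h e = h w - h v) ∧
      G.abelJacobi p (G.vertex w) =
        G.abelJacobi p (G.vertex v) + G.toJacobian (G.integral c) := by
  classical
  have key : ∀ e, G.abelJacobi p (G.vertex (G.head e)) =
      G.abelJacobi p (G.vertex (G.tail e)) + G.toJacobian (G.integral (edgeChain e)) := fun e => by
    rw [← point_len, abelJacobi_point_eq, div_self (G.len_pos e).ne', one_smul]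
  induction G.connected v w with
  | refl => exact ⟨0, fun _ => ⟨0, by simp⟩, by simp, by simp⟩
  | tail _ h ih =>
    obtain ⟨c, hc, hb, hA⟩ := ih
    obtain ⟨e, ⟨rfl, rfl⟩ | ⟨rfl, rfl⟩⟩ := h
    · refine ⟨c + edgeChain e, fun e' => ?_, fun h => ?_, ?_⟩
      · obtain ⟨n, hn⟩ := hc e'
        exact ⟨n + if e' = e then 1 else 0, by simp [hn, edgeChain, Pi.single_apply]⟩
      · simp only [Pi.add_apply, add_mul, Finset.sum_add_distrib, hb, sum_edgeChain_mul]
        rw [coboundary]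
        ring
      · rw [key, hA, map_add, toJacobian, toJacobian, toJacobian, QuotientAddGroup.mk_add,
          add_assoc]
    · refine ⟨c - edgeChain e, fun e' => ?_, fun h => ?_, ?_⟩
      · obtain ⟨n, hn⟩ := hc e'
        exact ⟨n - if e' = e then 1 else 0, by simp [hn, edgeChain, Pi.single_apply]⟩
      · simp only [Pi.sub_apply, sub_mul, Finset.sum_sub_distrib, hb, sum_edgeChain_mul]
        rw [coboundary]
        ring
      · rw [key] at hA
        rw [eq_sub_of_add_eq hA, map_sub, toJacobian, toJacobian, toJacobian,
          QuotientAddGroup.mk_sub, add_sub_assoc]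

/-- Interior points of distinct segments have distinct images unless the segment is a bridge. -/
theorem foster_eq_zero_of_abelJacobi_eq {p : G.Curve} {e e' : E} (hne : e ≠ e')
    {s : Icc (0 : ℝ) (G.len e)} {t : Icc (0 : ℝ) (G.len e')}
    (hs : 0 < (s : ℝ) ∧ (s : ℝ) < G.len e) (ht : 0 < (t : ℝ) ∧ (t : ℝ) < G.len e')
    (heq : G.abelJacobi p (G.point e s) = G.abelJacobi p (G.point e' t)) : G.foster e = 0 := by
  obtain ⟨c, hc, hb, hA⟩ := G.exists_chain_abelJacobi p (G.tail e) (G.tail e')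
  rw [abelJacobi_point_eq, abelJacobi_point_eq, hA, add_assoc, add_left_cancel_iff] at heq
  obtain ⟨σ, hσ, hσ0, hσ1⟩ : ∃ σ, σ = (s : ℝ) / G.len e ∧ 0 < σ ∧ σ < 1 :=
    ⟨_, rfl, div_pos hs.1 (G.len_pos e), (div_lt_one (G.len_pos e)).2 hs.2⟩
  obtain ⟨τ, hτ, hτ0, hτ1⟩ : ∃ τ, τ = (t : ℝ) / G.len e' ∧ 0 < τ ∧ τ < 1 :=
    ⟨_, rfl, div_pos ht.1 (G.len_pos e'), (div_lt_one (G.len_pos e')).2 ht.2⟩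
  rw [← hσ, ← hτ] at heq
  replace heq : G.toJacobian (σ • G.integral (edgeChain e)) =
    G.toJacobian (G.integral c + τ • G.integral (edgeChain e')) := heq
  obtain ⟨γ, hγ, hint⟩ := AddSubgroup.mem_map.1 (G.toJacobian_eq_iff.1 heq)
  replace hint : G.integral γ = G.integral c + τ • G.integral (edgeChain e') -
    σ • G.integral (edgeChain e) := hint
  -- the chain along a path between the two points, modified by a cycle
  let a : E → ℝ := c - γ + τ • edgeChain e' - σ • edgeChain e
  have ha0 : G.integral a = 0 := by
    simp only [a, map_sub, map_add, map_smul, hint]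
    abel
  have ha : ∀ γ ∈ G.cycles, G.chainInner γ a = 0 := fun γ hγ => by
    rw [chainInner_comm]
    exact LinearMap.congr_fun ha0 ⟨γ, G.mem_harmonic_iff.2 hγ⟩
  -- With `h` extended linearly along the edges, this is its value at the second point minus its
  -- value at the first.
  have hpair : ∀ h : V → ℝ, ∑ x, a x * G.coboundary h x =
      h (G.tail e') - h (G.tail e) + τ * G.coboundary h e' - σ * G.coboundary h e := fun h => by
    simp only [a, Pi.sub_apply, Pi.add_apply, Pi.smul_apply, smul_eq_mul, sub_mul, add_mul,
      Finset.sum_sub_distrib, Finset.sum_add_distrib, mul_assoc, ← Finset.mul_sum,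
      sum_edgeChain_mul, hb, G.sum_mul_coboundary_of_mem_cycles hγ.1]
    ring
  have haint : ∀ x, ∃ n : ℤ, a x = n + τ * edgeChain e' x - σ * edgeChain e x := fun x => by
    obtain ⟨m, hm⟩ := hc x
    obtain ⟨n, hn⟩ := hγ.2 x
    exact ⟨m - n, by simp [a, hm, hn]⟩
  obtain ⟨n, hn⟩ := haint e
  obtain ⟨m, hm⟩ := haint e'
  rw [edgeChain_self, edgeChain_of_ne hne, mul_zero, add_zero, mul_one] at hn
  rw [edgeChain_self, edgeChain_of_ne hne.symm, mul_zero, sub_zero, mul_one] at hm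
  -- The coefficient at `e` is an integer minus `σ`, where `0 < σ < 1`.
  have hae : a e ≠ 0 := fun h => by
    rw [hn] at h
    have h1 : (0 : ℝ) < n := by linarith
    have h2 : (n : ℝ) < 1 := by linarith
    have h3 : 0 < n := by exact_mod_cast h1
    have h4 : n < 1 := by exact_mod_cast h2
    omega
  obtain ⟨h, hh, h1, h2, h3⟩ := G.exists_cut ha hae
  have hnn : ∀ y, 0 ≤ a y * G.coboundary h y := fun y => by
    rw [h1 y]; positivity
  have hpe : 0 < a e * G.coboundary h e := by
    rw [h1]
    exact mul_pos (abs_pos.2 hae) (abs_pos.2 h3)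
  have hsum := hpair h
  have hup : 0 ≤ (1 - σ) * h (G.tail e) + σ * h (G.head e) := by
    have hnonneg : ∀ v, 0 ≤ h v := fun v => by rcases hh v with q | q <;> simp [q]
    exact add_nonneg (mul_nonneg (by linarith) (hnonneg _)) (mul_nonneg hσ0.le (hnonneg _))
  -- If `e'` crossed the cut, its term would by integrality be at least the interpolated value of
  -- `h` at the second point. The total flow is at most this value, which leaves nothing for the
  -- positive term of `e`.
  have he' : G.coboundary h e' = 0 := by
    by_contra h4
    have hle := Finset.add_le_sum (f := fun y => a y * G.coboundary h y) (s := Finset.univ)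
      (fun y _ => hnn y) (Finset.mem_univ e) (Finset.mem_univ e') hne
    rw [hsum] at hle
    have hpe' : 0 < a e' * G.coboundary h e' := by
      rw [h1]
      exact mul_pos (abs_pos.2 (h2 e' h4)) (abs_pos.2 h4)
    have hlow : (1 - τ) * h (G.tail e') + τ * h (G.head e') ≤ a e' * G.coboundary h e' := by
      unfold coboundary at hpe' h4 ⊢
      rcases hh (G.head e') with q1 | q1 <;> rcases hh (G.tail e') with q2 | q2 <;>
        rw [q1, q2] at hpe' h4 ⊢
      · exact absurd (sub_self _) h4
      · rw [hm] at hpe' ⊢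
        have h5 : (m : ℝ) < 0 := by linarith
        have h6 : m ≤ -1 := Int.le_sub_one_of_lt (by exact_mod_cast h5)
        have : (m : ℝ) ≤ -1 := by exact_mod_cast h6
        linarith
      · rw [hm] at hpe' ⊢
        have h5 : ((-1 : ℤ) : ℝ) < m := by push_cast; linarith
        have h6 : 0 ≤ m := Int.add_one_le_of_lt (by exact_mod_cast h5)
        have : (0 : ℝ) ≤ m := by exact_mod_cast h6
        linarith
      · exact absurd (sub_self _) h4
    simp only [coboundary] at hle hlow hpe
    linarith
  -- The total flow is now at most `1`. A further crossing edge has a nonzero integral coefficient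
  -- and would already use up `1`, in addition to the positive term of `e`.
  refine G.foster_eq_zero_of_cut h3 fun x hx => ?_
  by_contra h4
  have hxe' : x ≠ e' := fun h5 => h4 (h5 ▸ he')
  have hle := Finset.add_le_sum (f := fun y => a y * G.coboundary h y) (s := Finset.univ)
    (fun y _ => hnn y) (Finset.mem_univ e) (Finset.mem_univ x) hx.symm
  rw [hsum, he'] at hle
  obtain ⟨k, hk⟩ := haint x
  rw [edgeChain_of_ne hx, edgeChain_of_ne hxe', mul_zero, mul_zero, add_zero, sub_zero] at hk
  have hx1 : 1 ≤ a x * G.coboundary h x := by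
    rw [h1, G.abs_coboundary_of_ne hh h4, mul_one]
    have := h2 x h4
    rw [hk] at this ⊢
    exact_mod_cast Int.one_le_abs (by exact_mod_cast this)
  have ht1 : h (G.tail e') ≤ 1 := by rcases hh (G.tail e') with q | q <;> simp [q]
  simp only [coboundary] at hle hx1 hpe
  linarith

/-- Either `e` has `F(e) = 0` and a null image, or only images of endpoints can be shared. -/
theorem aedisjoint_abelJacobi_segment (p : G.Curve) {e e' : E} (h : e ≠ e') :
    AEDisjoint μH[1] (G.abelJacobi p '' G.segment e) (G.abelJacobi p '' G.segment e') := by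
  have := Measure.nullSingletonClass_hausdorff G.Jacobian one_pos
  by_cases hF : G.foster e = 0
  · refine measure_mono_null inter_subset_left ?_
    rw [hausdorffMeasure_abelJacobi_segment, hF, ENNReal.ofReal_zero]
  · refine measure_mono_null ?_ ((((G.finite_endpoints e).image fun t => G.abelJacobi p (G.point e t)).union
      ((G.finite_endpoints e').image fun t => G.abelJacobi p (G.point e' t))).measure_zero _)
    rintro _ ⟨⟨_, ⟨s, rfl⟩, rfl⟩, _, ⟨t, rfl⟩, ht⟩
    by_cases hs : (s : ℝ) = 0 ∨ (s : ℝ) = G.len e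
    · exact Or.inl ⟨s, hs, rfl⟩
    by_cases ht' : (t : ℝ) = 0 ∨ (t : ℝ) = G.len e'
    · exact Or.inr ⟨t, ht', ht⟩
    push Not at hs ht'
    exact absurd (G.foster_eq_zero_of_abelJacobi_eq h
      ⟨lt_of_le_of_ne s.2.1 hs.1.symm, lt_of_le_of_ne s.2.2 hs.2⟩
      ⟨lt_of_le_of_ne t.2.1 ht'.1.symm, lt_of_le_of_ne t.2.2 ht'.2⟩ ht.symm) hF

/-! ### The total length of the image -/

theorem isCompact_abelJacobi_segment (p : G.Curve) (e : E) :
    IsCompact (G.abelJacobi p '' G.segment e) := by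
  rw [segment, ← range_comp]
  refine isCompact_range (LipschitzWith.of_dist_le_mul (K := (G.foster e / G.len e).toNNReal)
    fun s t => ?_).continuous
  rw [Real.coe_toNNReal _ (div_nonneg (G.foster_nonneg e) (G.len_pos e).le), Subtype.dist_eq,
    Real.dist_eq]
  exact G.dist_abelJacobi_point_le p e s t

theorem sum_hausdorffMeasure_abelJacobi_segment (p : G.Curve) :
    ∑ e, μH[1] (G.abelJacobi p '' G.segment e) = G.genus := by
  simp only [hausdorffMeasure_abelJacobi_segment]
  rw [← ENNReal.ofReal_sum_of_nonneg fun e _ => G.foster_nonneg e, sum_foster,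
    ENNReal.ofReal_natCast]

/-- Additivity over the almost disjoint compact images of the segments. The vertices are added
separately because a graph without edges still has one; their finite image is null. -/
theorem hausdorffMeasure_range_abelJacobi (p : G.Curve) :
    μH[1] (range (G.abelJacobi p)) = G.genus := by
  have := Measure.nullSingletonClass_hausdorff G.Jacobian one_pos
  have := G.finite_vertices
  have hvert : μH[1] (G.abelJacobi p '' range G.vertex) = 0 :=
    ((Set.finite_range _).image _).measure_zero _
  have hseg : μH[1] (⋃ e, G.abelJacobi p '' G.segment e) = G.genus := by
    rw [measure_iUnion₀ (fun e e' h => G.aedisjoint_abelJacobi_segment p h)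
      fun e => (G.isCompact_abelJacobi_segment p e).measurableSet.nullMeasurableSet,
      tsum_fintype, sum_hausdorffMeasure_abelJacobi_segment]
  rw [← image_univ, univ_eq_vertices_union_segments, image_union, image_iUnion, ← hseg]
  refine le_antisymm ((measure_union_le _ _).trans ?_) (measure_mono subset_union_right)
  rw [hvert, zero_add]

end WeightedGraph

theorem mainTheorem3 {V E : Type*} [Fintype E] (G : WeightedGraph V E) (p : G.Curve) :
    (∀ e : E,
      eVariationOn (fun t => G.abelJacobi p (G.point e t)) univ = ENNReal.ofReal (G.foster e) ∧
      μH[1] (G.abelJacobi p '' G.segment e) = ENNReal.ofReal (G.foster e) ∧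
      G.zhangMeasure (G.segment e) = ENNReal.ofReal (G.foster e)) ∧
    μH[1] (range (G.abelJacobi p)) = G.genus ∧
    ∑ e, μH[1] (G.abelJacobi p '' G.segment e) = G.genus ∧
    (∀ e : E, μH[1] (G.abelJacobi p '' G.segment e) ≤ 1 ∧
      (μH[1] (G.abelJacobi p '' G.segment e) = 1 ↔ G.tail e = G.head e)) := by
  refine ⟨fun e => ⟨G.eVariationOn_abelJacobi_point p e,
    G.hausdorffMeasure_abelJacobi_segment p e, G.zhangMeasure_segment e⟩,
    G.hausdorffMeasure_range_abelJacobi p, G.sum_hausdorffMeasure_abelJacobi_segment p,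
    fun e => ?_⟩
  rw [G.hausdorffMeasure_abelJacobi_segment, ENNReal.ofReal_le_one, ENNReal.ofReal_eq_one,
    G.foster_eq_one_iff]
  exact ⟨G.foster_le_one e, Iff.rfl⟩
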